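/- **Definitions.** Let $\lambda,\mu$ be infinite cardinals. A topological space is $[\lambda,\mu]$-compact if every open cover by at most $\mu$ sets has a subcover by fewer than $\lambda$ sets. A family of topological spaces is productively $[\lambda,\mu]$-compact if every Tychonoff product (over an arbitrary index set) of members of the family, allowing repetitions, is $[\lambda,\mu]$-compact; a space $X$ is productively $[\lambda,\mu]$-compact if every Tychonoff power of $X$ is $[\lambda,\mu]$-compact. An ultrafilter $D$ over a set $J$ is $(\lambda,\mu)$-regular if there is a function $f$ from $J$ to the set of subsets of $\mu$ of cardinality $<\lambda$ such that $\{j\in J : \alpha\in f(j)\}\in D$ for every $\alpha\in\mu$. **Theorem.** For all infinite cardinals $\lambda,\mu$ and every family $(\kappa_i)_{i\in I}$ of infinite cardinals, the following are equivalent, where in (i) and in (v) the word "productively" in parentheses can equivalently be inserted or omitted: (i) Every productively $[\lambda,\mu]$-compact topological space is (productively) $[\kappa_i,\kappa_i]$-compact for some $i\in I$. (ii) Every productively $[\lambda,\mu]$-compact family of topological spaces is productively $[\kappa_i,\kappa_i]$-compact for some $i\in I$. (iii) Every $(\lambda,\mu)$-regular ultrafilter is $(\kappa_i,\kappa_i)$-regular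 for some $i\in I$. (iv) Every productively $[\lambda,\mu]$-compact Hausdorff normal topological space with a base of clopen sets is productively $[\kappa_i,\kappa_i]$-compact for some $i\in I$. (v) Every productively $[\lambda,\mu]$-compact Tychonoff topological group with a base of clopen sets is (productively) $[\kappa_i,\kappa_i]$-compact for some $i\in I$. If every $\kappa_i$ is regular, then the preceding conditions are also equivalent to: (vi) Every productively $[\lambda,\mu]$-compact Hausdorff normal topological space with a base of clopen sets is $[\kappa_i,\kappa_i]$-compact for some $i\in I$. -/

import Mathlib

open Cardinal

universe u

/-- `X` is `[l, m]`-compact: every open cover of `X` by at most `m` sets has a subcover by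
fewer than `l` sets. -/
def IsIntervalCompact (l m : Cardinal.{u}) (X : Type u) [TopologicalSpace X] : Prop :=
  ∀ U : Set (Set X), (∀ s ∈ U, IsOpen s) → #U ≤ m → ⋃₀ U = Set.univ →
    ∃ V : Set (Set X), V ⊆ U ∧ #V < l ∧ ⋃₀ V = Set.univ

/-- The family `X` is productively `[l, m]`-compact: every product, over an arbitrary index set,
of members of the family (with repetitions allowed) is `[l, m]`-compact in the Tychonoff
topology. -/
def IsProductivelyCompactFamily (l m : Cardinal.{u}) {J : Type u} (X : J → Type u)
    [∀ j, TopologicalSpace (X j)] : Prop :=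
  ∀ (K : Type u) (g : K → J), IsIntervalCompact l m (∀ k : K, X (g k))

/-- `X` is productively `[l, m]`-compact: every Tychonoff power of `X` is `[l, m]`-compact. -/
def IsProductivelyCompact (l m : Cardinal.{u}) (X : Type u) [TopologicalSpace X] : Prop :=
  ∀ K : Type u, IsIntervalCompact l m (K → X)

/-- An ultrafilter `D` over `J` is `(l, m)`-regular: there is a function `f` from `J` to the set
of subsets of `m` of cardinality `< l` such that `{j | a ∈ f j} ∈ D` for every `a ∈ m`.
Here `m.out` is a fixed set of cardinality `m`. -/
def IsRegularUltrafilter (l m : Cardinal.{u}) {J : Type u} (D : Ultrafilter J) : Prop :=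
  ∃ f : J → Set m.out, (∀ j, #(f j) < l) ∧ ∀ a : m.out, {j | a ∈ f j} ∈ D

/-- The clopen subsets of `X` form a base of the topology. -/
def HasClopenBase (X : Type u) [TopologicalSpace X] : Prop :=
  TopologicalSpace.IsTopologicalBasis {s : Set X | IsClopen s}

universe v

open Topology Filter

/-! Convergence along an ultrafilter passes to products, and a family is productively
$[\lambda,\mu]$-compact exactly when its members are all $D$-compact for one $(\lambda,\mu)$-regular
$D$ (`IsProductivelyCompactFamily.exists_ultrafilter`, `IsUltrafilterCompact.isIntervalCompact`).
Thus (iii) gives (ii), and with it every other condition.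

Conversely, let $D$ be $(\lambda,\mu)$-regular but $(\kappa_i,\kappa_i)$-regular for no $i$. Two
$D$-compact spaces refute the remaining conditions: a group of $\pm1$-valued functions with small
support, and the ordinals up to a bound without those limits to which $D$ has no unbounded map. The
second fails to be $E$-compact as soon as $E$ has an unbounded map into a removed limit. So
$(\kappa,\kappa)$-regularity must be expressed by unbounded maps: it is equivalent to having one
into $\kappa$ or into $\kappa^+$.

The hard case is $\kappa$ singular without an unbounded map into $\kappa$. The witnessing sets then
have size at most a fixed $\rho<\kappa$ almost everywhere.
`Cardinal.IsSingular.exists_sparse_family` gives $\kappa^+$ functions of which a set of size $\rho$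
can catch only boundedly many cofinally; these bounds form the map into $\kappa^+$. The family comes
from an eventually increasing sequence combined with club guessing. -/

/-- Recursion along a well-order, for a step which depends only on the values below. -/
theorem exists_eq_of_step {Θ A : Type*} [LinearOrder Θ] [WellFoundedLT Θ] [Nonempty A]
    (F : Θ → (Θ → A) → A) (hF : ∀ i x y, (∀ j < i, x j = y j) → F i x = F i y) :
    ∃ x : Θ → A, ∀ i, x i = F i x := by
  classical
  let G : (i : Θ) → ((j : Θ) → j < i → A) → A := fun i h =>
    F i (fun j => if hj : j < i then h j hj else Classical.arbitrary A)
  refine ⟨wellFounded_lt.fix G, fun i => ?_⟩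
  rw [WellFounded.fix_eq]
  exact hF _ _ _ fun j hj => by simp [hj]

/-! ### Club guessing -/

section ClubGuessing

attribute [local instance]
  WellFoundedLT.toOrderBot WellFoundedLT.conditionallyCompleteLinearOrderBot

theorem exists_forall_lt_of_mk_lt_cof {A : Type u} [LinearOrder A] {s : Set A}
    (hs : #s < Order.cof A) : ∃ b, ∀ x ∈ s, x < b := by
  by_contra! h
  exact (Order.cof_le (s := s) fun b => h b).not_gt hs

/-- Every club of a regular cardinal `τ` contains cofinally many elements below some point of
cofinality `θ`, for every regular `θ < τ`. -/
theorem IsClub.exists_limit {A : Type u} [LinearOrder A] [WellFoundedLT A] {θ : Cardinal.{u}}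
    (hθ : θ.IsRegular) (hA : θ < Order.cof A) {E : Set A} (hE : IsClub E) :
    ∃ a : A, (∀ x < a, ∃ y ∈ E, x < y ∧ y < a) ∧
      (∃ s ⊆ Set.Iio a, #s = θ ∧ ∀ x < a, ∃ y ∈ s, x < y) ∧
      ∀ s ⊆ Set.Iio a, (∀ x < a, ∃ y ∈ s, x < y) → θ ≤ #s := by
  classical
  have : Nonempty A := by
    rw [← Order.cof_ne_zero_iff]; exact (hθ.pos.trans hA).ne'
  let Θ := θ.ord.ToType
  have hΘ : #Θ = θ := mk_ord_toType θ
  have hcofΘ : Order.cof Θ = θ := by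
    rw [Ordinal.cof_toType, hθ.cof_ord]
  have hNM : NoMaxOrder Θ := Cardinal.noMaxOrder hθ.1
  have hbd : ∀ s : Set A, #s ≤ θ → ∃ b ∈ E, ∀ x ∈ s, x < b := by
    intro s hs
    obtain ⟨b, hb⟩ := exists_forall_lt_of_mk_lt_cof (hs.trans_lt hA)
    obtain ⟨e, he, hbe⟩ := hE.isCofinal b
    exact ⟨e, he, fun x hx => (hb x hx).trans_le hbe⟩
  choose! nx hnxE hnx using hbd
  -- A strictly increasing `θ`-sequence in `E`; its supremum is the required point, and it has
  -- cofinality `θ`.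
  obtain ⟨x, hx⟩ := exists_eq_of_step (Θ := Θ) (fun i x => nx (x '' Set.Iio i)) (by
    intro i x y h
    have : x '' Set.Iio i = y '' Set.Iio i := Set.image_congr h
    simp only [this])
  have hcard : ∀ t : Set Θ, #(x '' t) ≤ θ := fun t =>
    mk_image_le.trans ((mk_set_le t).trans hΘ.le)
  have hmono : StrictMono x := fun i j hij => by
    conv_rhs => rw [hx j]
    exact hnx _ (hcard _) _ ⟨i, hij, rfl⟩
  have hxE : ∀ i, x i ∈ E := fun i => by
    rw [hx i]; exact hnxE _ (hcard _)
  have hbdd : BddAbove (Set.range x) := by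
    obtain ⟨b, -, hb⟩ : ∃ b ∈ E, ∀ y ∈ Set.range x, y < b := by
      rw [← Set.image_univ]; exact ⟨_, hnxE _ (hcard _), hnx _ (hcard _)⟩
    exact ⟨b, fun y hy => (hb y hy).le⟩
  have hΘne : Nonempty Θ := by
    rw [← Cardinal.mk_ne_zero_iff, hΘ]; exact hθ.ne_zero
  set a := sSup (Set.range x) with ha
  have hlt : ∀ i, x i < a := fun i => by
    obtain ⟨j, hj⟩ := exists_gt i
    exact (hmono hj).trans_le (le_csSup hbdd ⟨j, rfl⟩)
  have hcof : ∀ y < a, ∃ i, y < x i := fun y hy => by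
    obtain ⟨_, ⟨i, rfl⟩, hi⟩ := exists_lt_of_lt_csSup (Set.range_nonempty x) hy
    exact ⟨i, hi⟩
  refine ⟨a, fun y hy => ?_, ⟨Set.range x, ?_, ?_, ?_⟩, fun s hsa hs => ?_⟩
  · obtain ⟨i, hi⟩ := hcof y hy
    exact ⟨x i, hxE i, hi, hlt i⟩
  · rintro _ ⟨i, rfl⟩; exact hlt i
  · rw [mk_range_eq _ hmono.injective, hΘ]
  · intro y hy
    obtain ⟨i, hi⟩ := hcof y hy
    exact ⟨x i, ⟨i, rfl⟩, hi⟩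
  · have h1 : Order.cof Θ = Order.cof (Set.Iio a) := by
      refine Order.cof_congr_of_strictMono (f := fun i => (⟨x i, hlt i⟩ : Set.Iio a))
        (fun i j h => hmono h) ?_
      rintro ⟨y, hy⟩
      obtain ⟨i, hi⟩ := hcof y hy
      exact ⟨_, ⟨i, rfl⟩, hi.le⟩
    rw [← hcofΘ, h1]
    have h2 : IsCofinal ((Subtype.val : Set.Iio a → A) ⁻¹' s) := by
      rintro ⟨y, hy⟩
      obtain ⟨z, hz, hyz⟩ := hs y hy
      exact ⟨⟨z, hsa hz⟩, hz, hyz.le⟩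
    exact (Order.cof_le h2).trans (mk_preimage_of_injective _ _ Subtype.val_injective)

/-- **Club guessing**: if `θ⁺ < τ` are regular, there is a family of `τ` subsets of `τ`, such that
every club of `τ` contains a member of size at least `θ` without a maximum. -/
theorem exists_club_guessing {A : Type u} [LinearOrder A] [WellFoundedLT A] {θ : Cardinal.{u}}
    (hθ : θ.IsRegular) (hA : Order.succ θ < Order.cof A) :
    ∃ c : A → Set A, ∀ E, IsClub E → ∃ a, c a ⊆ E ∧ θ ≤ #(c a) ∧ ∀ x ∈ c a, ∃ y ∈ c a, x < y := by
  classical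
  have hθA : θ < Order.cof A := (Order.lt_succ θ).trans hA
  have : Nonempty A := by
    rw [← Order.cof_ne_zero_iff]; exact (hθ.pos.trans hθA).ne'
  have hA0 : Order.cof A ≠ ℵ₀ := (hθ.1.trans_lt hθA).ne'
  by_contra! hno
  have hd : ∀ a : A, ∃ d : Set A, (∃ s ⊆ Set.Iio a, #s = θ ∧ ∀ x < a, ∃ y ∈ s, x < y) →
      d ⊆ Set.Iio a ∧ #d = θ ∧ ∀ x < a, ∃ y ∈ d, x < y := by
    intro a
    by_cases h : ∃ s ⊆ Set.Iio a, #s = θ ∧ ∀ x < a, ∃ y ∈ s, x < y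
    · obtain ⟨s, h1, h2, h3⟩ := h
      exact ⟨s, fun _ => ⟨h1, h2, h3⟩⟩
    · exact ⟨∅, fun h' => (h h').elim⟩
  choose d hd using hd
  -- The candidate guess pushes the ladder `d a` down into `E`. Excluding `⊥` discards the junk
  -- value `sSup ∅`, attained for `y` below all of `E`.
  let D : Set A → A → Set A := fun E a => {x | x ≠ ⊥ ∧ ∃ y ∈ d a, x = sSup (E ∩ Set.Iic y)}
  choose G hGclub hG using fun E => hno (D E)
  let Z := (Order.succ θ).ord.ToType
  have hZreg := isRegular_succ hθ.1
  have hZ : #Z = Order.succ θ := mk_ord_toType _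
  have hcofZ : Order.cof Z = Order.succ θ := by
    rw [Ordinal.cof_toType, hZreg.cof_ord]
  have hZNM : NoMaxOrder Z := Cardinal.noMaxOrder hZreg.1
  -- If each `D E` fails to guess the club `G E`, iterate `θ⁺` times, shrinking below all earlier `G
  -- (E i)`.
  obtain ⟨E, hE⟩ := exists_eq_of_step (Θ := Z) (A := Set A)
    (fun i x => ⋂ j : Set.Iio i, (x j ∩ G (x j))) (by
      intro i x y h
      refine Set.iInter_congr fun j => ?_
      rw [h j j.2])
  have hEclub : ∀ i, IsClub (E i) := by
    intro i
    induction i using WellFoundedLT.induction with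
    | ind i ih =>
      rw [hE i]
      refine IsClub.iInter hA0 ?_ fun j => (ih j j.2).inter hA0 (hGclub _)
      rw [Cardinal.lift_id, Cardinal.lift_id]
      exact ((mk_set_le _).trans hZ.le).trans_lt hA
  have hEanti : Antitone E := by
    intro i j hij
    rcases hij.eq_or_lt with rfl | hij
    · exact le_rfl
    · rw [hE j]
      exact (Set.iInter_subset _ (⟨i, hij⟩ : Set.Iio j)).trans Set.inter_subset_left
  have hEG : ∀ i j, i < j → E j ⊆ G (E i) := fun i j hij => by
    rw [hE j]
    exact (Set.iInter_subset _ (⟨i, hij⟩ : Set.Iio j)).trans Set.inter_subset_right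
  have hEi : IsClub (⋂ i, E i) := by
    refine IsClub.iInter hA0 ?_ hEclub
    rw [Cardinal.lift_id, Cardinal.lift_id, hZ]
    exact hA
  obtain ⟨a, ha1, ha2, ha3⟩ := hEi.exists_limit hθ hθA
  obtain ⟨hda, hdθ, hdcof⟩ := hd a ha2
  let p : Z → A → A := fun i y => sSup (E i ∩ Set.Iic y)
  have hbdd : ∀ i y, BddAbove (E i ∩ Set.Iic y) := fun i y => ⟨y, fun z hz => hz.2⟩
  have hpanti : ∀ y, Antitone fun i => p i y := fun y i j hij =>
    csSup_le_csSup' (hbdd i y) (Set.inter_subset_inter_left _ (hEanti hij))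
  have hZne : Nonempty Z := by
    rw [← Cardinal.mk_ne_zero_iff, hZ]; exact hZreg.ne_zero
  have hstab : ∀ y, ∃ i, ∀ j, i ≤ j → p j y = p i y := fun y => by
    obtain ⟨_, ⟨i, rfl⟩, hi⟩ := WellFounded.has_min wellFounded_lt (Set.range fun i => p i y)
      (Set.range_nonempty _)
    exact ⟨i, fun j hij => le_antisymm (hpanti y hij) (not_lt.1 (hi _ ⟨j, rfl⟩))⟩
  choose st hst using hstab
  -- Each projection decreases with the stage, hence stabilizes. There are only `θ` of them, so one
  -- stage below `θ⁺` works for all; from then on `D (E i) a` lies in the next club, hence in `G (E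
  -- i)`, contradicting the choice of `G`.
  obtain ⟨i, hi⟩ : ∃ i, ∀ x ∈ st '' d a, x < i := by
    refine exists_forall_lt_of_mk_lt_cof ?_
    rw [hcofZ]
    exact mk_image_le.trans_lt (hdθ.trans_lt (Order.lt_succ θ))
  obtain ⟨j, hij⟩ := exists_gt i
  have hDcof : ∀ x < a, ∃ y ∈ D (E i) a, x < y := by
    intro x hx
    obtain ⟨e, he, hxe, hea⟩ := ha1 x hx
    obtain ⟨y, hy, hey⟩ := hdcof e hea
    have hle : e ≤ sSup (E i ∩ Set.Iic y) :=
      le_csSup (hbdd i y) ⟨Set.mem_iInter.1 he i, hey.le⟩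
    exact ⟨_, ⟨(bot_le.trans_lt (hxe.trans_le hle)).ne', y, hy, rfl⟩, hxe.trans_le hle⟩
  have hDa : D (E i) a ⊆ Set.Iio a := by
    rintro x ⟨-, y, hy, rfl⟩
    exact (csSup_le' fun z hz => hz.2 : _ ≤ y).trans_lt (hda hy)
  obtain ⟨x, hx, hmax⟩ := hG (E i) a (by
    rintro x ⟨hx0, y, hy, rfl⟩
    have hpij : p i y = p j y := by
      have hlt := hi _ ⟨y, hy, rfl⟩
      rw [hst y i hlt.le, hst y j (hlt.trans hij).le]
    change p i y ∈ _
    change p i y ≠ ⊥ at hx0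
    rw [hpij] at hx0 ⊢
    have hne : (E j ∩ Set.Iic y).Nonempty := by
      by_contra h
      rw [Set.not_nonempty_iff_eq_empty] at h
      exact hx0 (by simp only [p, h]; exact csSup_empty)
    exact hEG i j hij ((hEclub j).isLUB_mem Set.inter_subset_left hne
      (isLUB_csSup hne (hbdd j y)))) (ha3 _ hDa hDcof)
  obtain ⟨y, hy, hxy⟩ := hDcof x (hDa hx)
  exact (hmax y hy).not_gt hxy

end ClubGuessing

/-! ### Increasing sequences and sparse families on a singular cardinal -/

/-- Two normal functions with the same supremum agree on a club. -/
theorem Order.IsNormal.isClub_setOf_eq {A : Type u} {W : Type*} [LinearOrder A] [WellFoundedLT A]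
    [LinearOrder W] (hA : ℵ₀ < Order.cof A) {x y : A → W} (hx : Order.IsNormal x)
    (hy : Order.IsNormal y) {δ : W} (hxδ : IsLUB (Set.range x) δ) (hyδ : IsLUB (Set.range y) δ) :
    IsClub {l | x l = y l} := by
  refine ⟨fun s hs hs0 _ a ha => ?_, fun a => ?_⟩
  · have h1 := hx.map_isLUB ha hs0
    rw [Set.image_congr (fun l hl => hs hl)] at h1
    exact h1.unique (hy.map_isLUB ha hs0)
  · have hstep : ∀ l : A, ∃ l', l < l' ∧ x l < y l' ∧ y l < x l' := by
      intro l
      obtain ⟨l1, hl1⟩ : ∃ b, ∀ z ∈ ({l} : Set A), z < b :=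
        exists_forall_lt_of_mk_lt_cof ((mk_singleton l).trans_lt (one_lt_aleph0.trans hA))
      replace hl1 := hl1 l rfl
      obtain ⟨_, ⟨l2, rfl⟩, hl2⟩ :=
        (lt_isLUB_iff hyδ).1 ((hx.strictMono hl1).trans_le (hxδ.1 ⟨l1, rfl⟩))
      obtain ⟨_, ⟨l3, rfl⟩, hl3⟩ :=
        (lt_isLUB_iff hxδ).1 ((hy.strictMono hl1).trans_le (hyδ.1 ⟨l1, rfl⟩))
      refine ⟨max l1 (max l2 l3), hl1.trans_le (le_max_left _ _), hl2.trans_le ?_,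
        hl3.trans_le ?_⟩
      · exact hy.monotone ((le_max_left _ _).trans (le_max_right _ _))
      · exact hx.monotone ((le_max_right _ _).trans (le_max_right _ _))
    choose n hn1 hn2 hn3 using hstep
    -- The values of `x` and `y` interleave along `q`, so by continuity they agree at its supremum.
    let q : ℕ → A := fun k => n^[k] a
    have hq : ∀ k, q (k + 1) = n (q k) := fun k => Function.iterate_succ_apply' n k a
    have hbd : BddAbove (Set.range q) := by
      obtain ⟨b, hb⟩ := exists_forall_lt_of_mk_lt_cof (s := Set.range q) (by
        refine lt_of_le_of_lt ?_ hA
        exact (Set.countable_range q).le_aleph0)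
      exact ⟨b, fun z hz => (hb z hz).le⟩
    obtain ⟨c, hc⟩ : ∃ c, IsLUB (Set.range q) c :=
      ⟨_, WellFounded.min_mem wellFounded_lt (upperBounds (Set.range q)) hbd,
        fun b hb => WellFounded.min_le wellFounded_lt hb⟩
    refine ⟨c, ?_, hc.1 ⟨0, rfl⟩⟩
    have h1 := hx.map_isLUB hc (Set.range_nonempty q)
    have h2 := hy.map_isLUB hc (Set.range_nonempty q)
    refine le_antisymm (h1.2 ?_) (h2.2 ?_)
    · rintro _ ⟨_, ⟨k, rfl⟩, rfl⟩
      refine (hn2 (q k)).le.trans (h2.1 ⟨_, ⟨k + 1, rfl⟩, ?_⟩)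
      rw [hq]
    · rintro _ ⟨_, ⟨k, rfl⟩, rfl⟩
      refine (hn3 (q k)).le.trans (h1.1 ⟨_, ⟨k + 1, rfl⟩, ?_⟩)
      rw [hq]

theorem Ordinal.mk_Iio_toTypeMk {o a : Ordinal.{u}} (h : a < o) :
    #(Set.Iio (Ordinal.ToType.mk ⟨a, h⟩ : o.ToType)) = a.card := by
  have h2 := Ordinal.card_typein (α := o.ToType) (r := (· < ·)) (Ordinal.ToType.mk ⟨a, h⟩)
  have h3 : Ordinal.typein (α := o.ToType) (· < ·) (Ordinal.ToType.mk ⟨a, h⟩) = a :=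
    congrArg Subtype.val (Ordinal.ToType.mk.symm_apply_apply ⟨a, h⟩)
  rw [h3] at h2
  exact h2.symm

/-- For a singular cardinal `κ` there is an eventually increasing sequence of length `κ⁺` of
functions on `κ`, which eventually dominates the pointwise supremum along a club at every point
of cofinality `cof A`. -/
theorem Cardinal.IsSingular.exists_increasing_sequence {κ : Cardinal.{u}} (hκ : κ.IsSingular)
    {A : Type u} [LinearOrder A] [WellFoundedLT A] (hA : ℵ₀ < Order.cof A) (hAκ : #A < κ) :
    ∃ g : (Order.succ κ).ord.ToType → κ.ord.ToType → κ.ord.ToType,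
      (∀ a b, a < b → ∃ s₀, ∀ s, s₀ ≤ s → g a s < g b s) ∧
      ∀ x : A → (Order.succ κ).ord.ToType, Order.IsNormal x → ∀ δ, IsLUB (Set.range x) δ →
        ∃ E, IsClub E ∧ ∃ s₀, ∀ s, s₀ ≤ s → ∀ l ∈ E, g (x l) s < g δ s := by
  classical
  set W := (Order.succ κ).ord.ToType with hW
  set K := κ.ord.ToType with hK
  have hKcard : #K = κ := mk_ord_toType κ
  have hNM : NoMaxOrder K := Cardinal.noMaxOrder hκ.aleph0_le
  have hANM : ∀ l : A, ∃ l', l < l' := fun l => by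
    obtain ⟨b, hb⟩ := exists_forall_lt_of_mk_lt_cof (s := {l})
      ((mk_singleton l).trans_lt (one_lt_aleph0.trans hA))
    exact ⟨b, hb l rfl⟩
  have hIioK : ∀ s : K, #(Set.Iio s) < κ := fun s => by
    have := mk_Iio_lt s (by simp [K]); rwa [hKcard] at this
  have hIioW : ∀ w : W, #(Set.Iio w) ≤ #K := fun w => by
    have := mk_Iio_lt w (by simp [W])
    rw [hKcard, ← Order.lt_succ_iff]
    simpa [W] using this
  have he : ∀ w : W, Nonempty (Set.Iio w ↪ K) := fun w => hIioW w
  let e : (w : W) → Set.Iio w ↪ K := fun w => (he w).some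
  have hy : ∀ δ : W, ∃ y : A → W, (∃ x : A → W, Order.IsNormal x ∧ IsLUB (Set.range x) δ) →
      Order.IsNormal y ∧ IsLUB (Set.range y) δ := by
    intro δ
    by_cases h : ∃ x : A → W, Order.IsNormal x ∧ IsLUB (Set.range x) δ
    · obtain ⟨x, hx⟩ := h; exact ⟨x, fun _ => hx⟩
    · have : Nonempty (A → W) := ⟨fun _ => δ⟩
      exact ⟨Classical.arbitrary _, fun h' => (h h').elim⟩
  choose y hy using hy
  -- The functions are the ranks of the relations `R s`. The first alternative eventually relates
  -- any `a < b`; the second makes a chosen normal sequence below `b` precede `b`, once `s` is large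
  -- enough to afford `#A` predecessors.
  let R : K → W → W → Prop := fun s a b =>
    ∃ h : a < b, e b ⟨a, h⟩ < s ∨ (#A ≤ #(Set.Iio s) ∧ a ∈ Set.range (y b))
  have hwf : ∀ s, IsWellFounded W (R s) := fun s =>
    ⟨Subrelation.wf (fun ⟨h, _⟩ => h) (wellFounded_lt (α := W))⟩
  have hℵ : ℵ₀ < κ := lt_of_le_of_ne hκ.aleph0_le (by
    rintro rfl; exact not_isSingular_aleph0 hκ)
  have hRcard : ∀ s b, #{a // R s a b} ≤ max #(Set.Iio s) ℵ₀ := by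
    intro s b
    have hsub : {a | R s a b} ⊆ (Subtype.val '' (e b ⁻¹' Set.Iio s)) ∪
        (if #A ≤ #(Set.Iio s) then Set.range (y b) else ∅) := by
      rintro a ⟨hab, h | ⟨h, h'⟩⟩
      · exact Or.inl ⟨⟨a, hab⟩, h, rfl⟩
      · right; rw [if_pos h]; exact h'
    have h1 : #(Subtype.val '' (e b ⁻¹' Set.Iio s) : Set W) ≤ #(Set.Iio s) :=
      mk_image_le.trans (mk_preimage_of_injective _ _ (e b).injective)
    have h2 : #(if #A ≤ #(Set.Iio s) then Set.range (y b) else ∅ : Set W) ≤ #(Set.Iio s) := by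
      split_ifs with h
      · exact mk_range_le.trans h
      · simp
    calc #{a // R s a b} ≤ _ := mk_le_mk_of_subset hsub
      _ ≤ _ := mk_union_le _ _
      _ ≤ max #(Set.Iio s) ℵ₀ + max #(Set.Iio s) ℵ₀ :=
        add_le_add (h1.trans (le_max_left _ _)) (h2.trans (le_max_left _ _))
      _ = _ := add_eq_self (le_max_right _ _)
  -- Few predecessors keep the rank below a successor cardinal, by its regularity; this successor is
  -- below `κ`, which is a limit cardinal.
  have hrank : ∀ s b, (hwf s).rank (R s) b < (Order.succ (max #(Set.Iio s) ℵ₀)).ord := by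
    intro s b
    have := hwf s
    induction b using WellFoundedLT.induction with
    | ind b ih =>
      rw [IsWellFounded.rank_eq]
      refine Ordinal.iSup_add_one_lt_of_lt_cof ?_ fun a => ih a a.2.1
      rw [(isRegular_succ (le_max_right _ _)).cof_ord]
      exact (hRcard s b).trans_lt (Order.lt_succ _)
  have hrankκ : ∀ s b, (hwf s).rank (R s) b < κ.ord := fun s b =>
    (hrank s b).trans (ord_lt_ord.2 (hκ.isSuccLimit.succ_lt (max_lt (hIioK s) hℵ)))
  refine ⟨fun b s => Ordinal.ToType.mk ⟨(hwf s).rank (R s) b, hrankκ s b⟩, ?_, ?_⟩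
  · intro a b hab
    obtain ⟨s₀, hs₀⟩ := exists_gt (e b ⟨a, hab⟩)
    refine ⟨s₀, fun s hs => ?_⟩
    have := hwf s
    simp only [OrderIso.lt_iff_lt]
    exact IsWellFounded.rank_lt_of_rel (r := R s) ⟨hab, Or.inl (hs₀.trans_le hs)⟩
  · intro x hx δ hδ
    obtain ⟨hyn, hyl⟩ := hy δ ⟨x, hx, hδ⟩
    refine ⟨_, hx.isClub_setOf_eq hA hyn hδ hyl, ?_⟩
    have hlt : (#A).ord < κ.ord := ord_lt_ord.2 hAκ
    refine ⟨Ordinal.ToType.mk ⟨(#A).ord, hlt⟩, fun s hs l hl => ?_⟩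
    have := hwf s
    simp only [OrderIso.lt_iff_lt]
    refine IsWellFounded.rank_lt_of_rel (r := R s) ⟨?_, Or.inr ⟨?_, ⟨l, hl.symm⟩⟩⟩
    · obtain ⟨l', hl'⟩ := hANM l
      exact (hx.strictMono hl').trans_le (hδ.1 ⟨l', rfl⟩)
    · have h1 : #(Set.Iio (Ordinal.ToType.mk ⟨(#A).ord, hlt⟩ : K)) = #A :=
        (Ordinal.mk_Iio_toTypeMk hlt).trans (card_ord _)
      rw [← h1]
      exact mk_le_mk_of_subset (Set.Iio_subset_Iio hs)

section
attribute [local instance]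
  WellFoundedLT.toOrderBot WellFoundedLT.conditionallyCompleteLinearOrderBot

/-- For a singular cardinal `κ` and `ρ < κ`, there are `κ⁺` functions from a cofinal subset of `κ`
to `κ`, such that every set of size at most `ρ` meets only boundedly many of them cofinally. -/
theorem Cardinal.IsSingular.exists_sparse_family {κ ρ : Cardinal.{u}} (hκ : κ.IsSingular)
    (hρ : ρ < κ) :
    ∃ S : Set κ.ord.ToType, IsCofinal S ∧
      ∃ g : (Order.succ κ).ord.ToType → κ.ord.ToType → κ.ord.ToType,
        ∀ f : Set κ.ord.ToType, #f ≤ ρ →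
          ∃ b, ∀ a, (∀ s₀, ∃ s ∈ S, s₀ ≤ s ∧ g a s ∈ f) → a < b := by
  classical
  set W := (Order.succ κ).ord.ToType with hW
  set K := κ.ord.ToType with hK
  have hℵ : ℵ₀ < κ := lt_of_le_of_ne hκ.aleph0_le (by
    rintro rfl; exact not_isSingular_aleph0 hκ)
  obtain ⟨S, hS, hScard⟩ := Order.exists_cof_eq K
  have hSκ : #S < κ := by
    rw [hScard, Ordinal.cof_toType]; exact hκ.cof_ord_lt
  -- `θ` exceeds `#S * #f`, and `τ = θ⁺⁺` leaves the gap which club guessing needs.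
  let m := max (max ρ #S) ℵ₀
  have hm : ℵ₀ ≤ m := le_max_right _ _
  have hmκ : m < κ := max_lt (max_lt hρ hSκ) hℵ
  let θ := Order.succ m
  have hθ : θ.IsRegular := isRegular_succ hm
  let τ := Order.succ (Order.succ θ)
  have hτ : τ.IsRegular := isRegular_succ (hθ.1.trans (Order.le_succ _))
  have hτκ : τ < κ :=
    hκ.isSuccLimit.succ_lt (hκ.isSuccLimit.succ_lt (hκ.isSuccLimit.succ_lt hmκ))
  let A := τ.ord.ToType
  have hAcard : #A = τ := mk_ord_toType τ
  have hcofA : Order.cof A = τ := by rw [Ordinal.cof_toType, hτ.cof_ord]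
  have hAℵ : ℵ₀ < Order.cof A := by
    rw [hcofA]
    exact hm.trans_lt ((Order.lt_succ m).trans ((Order.lt_succ _).trans (Order.lt_succ _)))
  obtain ⟨c, hc⟩ := exists_club_guessing (A := A) hθ (by rw [hcofA]; exact Order.lt_succ _)
  obtain ⟨g, hg1, hg2⟩ := hκ.exists_increasing_sequence hAℵ (by rw [hAcard]; exact hτκ)
  refine ⟨S, hS, g, fun f hf => ?_⟩
  by_contra! hT
  have hWreg : (Order.succ κ).IsRegular := isRegular_succ hκ.aleph0_le
  have hcofW : Order.cof W = Order.succ κ := by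
    rw [Ordinal.cof_toType, hWreg.cof_ord]
  have hWne : Nonempty W := by
    rw [← Order.cof_ne_zero_iff, hcofW]; exact hWreg.ne_zero
  have hANM : NoMaxOrder A := Cardinal.noMaxOrder hτ.1
  have hAne : Nonempty A := by
    rw [← Order.cof_ne_zero_iff, hcofA]; exact hτ.ne_zero
  let T : Set W := {a | ∀ s₀, ∃ s ∈ S, s₀ ≤ s ∧ g a s ∈ f}
  have hpick : ∀ P : Set W, #P ≤ κ → ∃ t ∈ T, ∀ p ∈ P, p < t := by
    intro P hP
    obtain ⟨b, hb⟩ := exists_forall_lt_of_mk_lt_cof (s := P)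
      (by rw [hcofW]; exact Order.lt_succ_of_le hP)
    obtain ⟨t, ht, hbt⟩ := hT b
    exact ⟨t, ht, fun p hp => (hb p hp).trans_le hbt⟩
  choose! pick hpickT hpick using hpick
  let Dom : Set W → W → Prop := fun P b => ∃ s₀, ∀ s, s₀ ≤ s → ∀ p ∈ P, g p s < g b s
  have hDom : ∀ P a b, a < b → Dom P a → Dom P b := by
    rintro P a b hab ⟨s₀, hs₀⟩
    obtain ⟨s₁, hs₁⟩ := hg1 a b hab
    exact ⟨max s₀ s₁, fun s hs p hp => (hs₀ s ((le_max_left _ _).trans hs) p hp).trans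
      (hs₁ s ((le_max_right _ _).trans hs))⟩
  have hN : ∀ P : Set W, ∃ b, (∃ b, Dom P b) → Dom P b := by
    intro P
    by_cases h : ∃ b, Dom P b
    · obtain ⟨b, hb⟩ := h; exact ⟨b, fun _ => hb⟩
    · exact ⟨Classical.arbitrary W, fun h' => (h h').elim⟩
  choose N hN using hN
  let tt : A → (A → W) → W := fun l x =>
    pick (insert (x l) (Set.range fun α : A => N (x '' (c α ∩ Set.Iic l))))
  -- Taking the least point above all earlier `tt l' x` makes `x` continuous.
  obtain ⟨x, hx⟩ := exists_eq_of_step (Θ := A) (A := W)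
    (fun l x => sInf {w | ∀ l' < l, tt l' x < w}) (by
      intro l x y h
      have : ∀ l' < l, tt l' x = tt l' y := by
        intro l' hl'
        have h2 : ∀ α, x '' (c α ∩ Set.Iic l') = y '' (c α ∩ Set.Iic l') := fun α =>
          Set.image_congr fun i hi => h i (lt_of_le_of_lt hi.2 hl')
        simp only [tt, h2, h l' hl']
      congr 1
      ext w
      exact forall₂_congr fun l' hl' => by rw [this l' hl'])
  have hτκ' : τ ≤ κ := hτκ.le
  have hsmall : ∀ l, #(insert (x l)
      (Set.range fun α : A => N (x '' (c α ∩ Set.Iic l))) : Set W) ≤ κ := fun l =>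
    mk_insert_le.trans ((add_le_add_left (mk_range_le.trans (hAcard.le.trans hτκ')) 1).trans
      (add_one_eq hκ.aleph0_le).le)
  let t : A → W := fun l => tt l x
  have htT : ∀ l, t l ∈ T := fun l => hpickT _ (hsmall l)
  have hxt : ∀ l, x l < t l := fun l => hpick _ (hsmall l) _ (Set.mem_insert _ _)
  have hNt : ∀ α l, N (x '' (c α ∩ Set.Iic l)) < t l := fun α l =>
    hpick _ (hsmall l) _ (Set.mem_insert_of_mem _ ⟨α, rfl⟩)
  have hbound : ∀ s : Set A, ∃ w : W, ∀ l ∈ s, t l < w := by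
    intro s
    obtain ⟨b, hb⟩ := exists_forall_lt_of_mk_lt_cof (s := t '' s) (by
      rw [hcofW]
      exact Order.lt_succ_of_le (mk_image_le.trans ((mk_set_le _).trans (hAcard.le.trans hτκ'))))
    exact ⟨b, fun l hl => hb _ ⟨l, hl, rfl⟩⟩
  have htx : ∀ l' l, l' < l → t l' < x l := by
    intro l' l h
    have := csInf_mem (s := {w | ∀ l' < l, t l' < w}) (hbound (Set.Iio l))
    rw [hx l]
    exact this l' h
  have hxnormal : Order.IsNormal x := by
    rw [Order.isNormal_iff]
    refine ⟨fun l' l h => (hxt l').trans (htx l' l h), fun l hl a ha => ?_⟩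
    rw [hx l]
    refine csInf_le' fun l' hl' => ?_
    obtain ⟨l'', h1, h2⟩ : ∃ l'', l' < l'' ∧ l'' < l := by
      by_contra! h
      exact hl.isSuccPrelimit l' ⟨hl', fun z hz hz' => (h z hz).not_gt hz'⟩
    exact (htx l' l'' h1).trans_le (ha l'' h2)
  obtain ⟨w, hw⟩ := hbound Set.univ
  have hbdd : BddAbove (Set.range x) :=
    ⟨w, by rintro _ ⟨l, rfl⟩; exact ((hxt l).trans (hw l trivial)).le⟩
  have hδ := isLUB_csSup (Set.range_nonempty x) hbdd
  set δ := sSup (Set.range x)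
  obtain ⟨E, hE, s₀, hs₀⟩ := hg2 x hxnormal δ hδ
  obtain ⟨α, hαE, hαθ, hαmax⟩ := hc E hE
  have hdom : ∀ l, Dom (x '' (c α ∩ Set.Iic l)) (t l) := by
    intro l
    refine hDom _ _ _ (hNt α l) (hN _ ⟨δ, s₀, ?_⟩)
    rintro s hs _ ⟨i, hi, rfl⟩
    exact hs₀ s hs i (hαE hi.1)
  have hstep : ∀ l : c α, ∃ s₁, ∀ s, s₁ ≤ s →
      (∀ i ∈ c α, i ≤ l → g (x i) s < g (t l) s) ∧ ∃ j ∈ c α, l.1 < j ∧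
        (∀ i ∈ c α, l.1 < i → j ≤ i) ∧ g (t l) s < g (x j) s := by
    rintro ⟨l, hl⟩
    obtain ⟨s₁, hs₁⟩ := hdom l
    obtain ⟨j, ⟨hj1, hj2⟩, hj3⟩ := WellFounded.has_min wellFounded_lt (c α ∩ Set.Ioi l) (hαmax l hl)
    obtain ⟨s₂, hs₂⟩ := hg1 (t l) (x j) (htx l j hj2)
    refine ⟨max s₁ s₂, fun s hs => ⟨fun i hi hil => ?_, j, hj1, hj2, fun i hi hil => ?_, ?_⟩⟩
    · exact hs₁ s ((le_max_left _ _).trans hs) _ ⟨i, ⟨hi, hil⟩, rfl⟩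
    · exact not_lt.1 (hj3 i ⟨hi, hil⟩)
    · exact hs₂ s ((le_max_right _ _).trans hs)
  choose s₁ hs₁ using hstep
  have hr : ∀ l : c α, ∃ r ∈ S, s₁ l ≤ r ∧ g (t l) r ∈ f := fun l => htT l (s₁ l)
  choose r hrS hrs hrf using hr
  -- For `l < l'` in `c α`, the value of `g (t l)` lies below that of `g (x j)`, with `j` the
  -- successor of `l` in `c α`, and this below that of `g (t l')`. Hence `F` is injective, although
  -- `c α` is larger than `S × f`.
  let F : c α → S × f := fun l => (⟨r l, hrS l⟩, ⟨g (t l) (r l), hrf l⟩)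
  have key : ∀ l l' : c α, l < l' → F l ≠ F l' := by
    intro l l' hll' hF
    have h1 : r l = r l' := congrArg (fun p => p.1.1) hF
    have h2 : g (t l) (r l) = g (t l') (r l') := congrArg (fun p => p.2.1) hF
    obtain ⟨-, j, hj, hlj, hjmin, hlt⟩ := hs₁ l (r l) (hrs l)
    have h3 := (hs₁ l' (r l') (hrs l')).1 j hj (hjmin l' l'.2 hll')
    rw [h1] at hlt h2
    exact (hlt.trans h3).ne h2
  have hinj : Function.Injective F := by
    intro l l' h
    by_contra hne
    rcases lt_or_gt_of_ne hne with h' | h'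
    · exact key l l' h' h
    · exact key l' l h' h.symm
  have h1 := mk_le_of_injective hinj
  rw [mk_prod, lift_id, lift_id] at h1
  have h2 : #S * #f ≤ m := (mul_le_mul' (((le_max_right _ _).trans (le_max_left _ _)) : #S ≤ m)
    (hf.trans ((le_max_left _ _).trans (le_max_left _ _)))).trans (mul_eq_self hm).le
  exact ((hαθ.trans h1).trans h2).not_gt (Order.lt_succ m)

end

/-! ### Regularity of ultrafilters and unbounded maps -/

/-- There is a map into `A` which is unbounded modulo the ultrafilter `D`. -/
def HasUnboundedMap {J : Type u} (D : Ultrafilter J) (A : Type u) [LT A] : Prop :=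
  ∃ h : J → A, ∀ a, ∀ᶠ j in D, a < h j

theorem eventually_le_of_not_hasUnboundedMap {J : Type u} {D : Ultrafilter J} {A : Type u}
    [LinearOrder A] (hD : ¬ HasUnboundedMap D A) (h : J → A) : ∃ a, ∀ᶠ j in D, h j ≤ a := by
  by_contra! hno
  exact hD ⟨h, hno⟩

theorem IsRegularUltrafilter.of_eventually {J : Type u} {D : Ultrafilter J} {l m : Cardinal.{u}}
    (hl : 0 < l) {Z : Type u} (hZ : m ≤ #Z) (f : J → Set Z) (hf : ∀ᶠ j in D, #(f j) < l)
    (h : ∀ z, ∀ᶠ j in D, z ∈ f j) : IsRegularUltrafilter l m D := by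
  classical
  obtain ⟨e⟩ : Nonempty (m.out ↪ Z) := by
    rw [← mk_out m] at hZ; exact hZ
  refine ⟨fun j => if #(f j) < l then e ⁻¹' f j else ∅, fun j => ?_, fun a => ?_⟩
  · dsimp only
    split_ifs with hj
    · exact (mk_preimage_of_injective _ _ e.injective).trans_lt hj
    · simpa using hl
  · filter_upwards [hf, h (e a)] with j h1 h2
    simpa [h1] using h2

theorem IsRegularUltrafilter.exists_map {J : Type u} {D : Ultrafilter J} {l m : Cardinal.{u}}
    (h : IsRegularUltrafilter l m D) {Z : Type u} (hZ : #Z = m) :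
    ∃ f : J → Set Z, (∀ j, #(f j) < l) ∧ ∀ z, ∀ᶠ j in D, z ∈ f j := by
  obtain ⟨f, hf, hfD⟩ := h
  obtain ⟨e⟩ : Nonempty (Z ≃ m.out) := by
    rw [← Cardinal.eq, mk_out, hZ]
  exact ⟨fun j => e ⁻¹' f j, fun j =>
    (mk_preimage_of_injective _ _ e.injective).trans_lt (hf j), fun z => hfD (e z)⟩

theorem mk_Iio_ord_toType_lt {κ : Cardinal.{u}} (s : κ.ord.ToType) : #(Set.Iio s) < κ := by
  have := mk_Iio_lt s (by simp)
  rwa [mk_ord_toType] at this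

theorem mk_Iic_ord_toType_lt {κ : Cardinal.{u}} (hκ : ℵ₀ ≤ κ) (s : κ.ord.ToType) :
    #(Set.Iic s) < κ := by
  have := Cardinal.noMaxOrder hκ
  obtain ⟨t, ht⟩ := exists_gt s
  exact (mk_le_mk_of_subset (Set.Iic_subset_Iio.2 ht)).trans_lt (mk_Iio_ord_toType_lt t)

theorem HasUnboundedMap.isRegularUltrafilter {J : Type u} {D : Ultrafilter J} {κ : Cardinal.{u}}
    (hκ : ℵ₀ ≤ κ) (h : HasUnboundedMap D κ.ord.ToType) : IsRegularUltrafilter κ κ D := by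
  obtain ⟨h, hh⟩ := h
  exact .of_eventually (aleph0_pos.trans_le hκ) (mk_ord_toType κ).ge (fun j => Set.Iio (h j))
    (.of_forall fun j => mk_Iio_ord_toType_lt _) hh

/-- Inject each initial segment of `κ⁺` into `κ`. Without an unbounded map into `κ`, the code of `a`
in the segment below `h j` is bounded almost everywhere by some `k a`. By pigeonhole one bound `b`
serves `κ⁺` many `a`, and fewer than `κ` codes lie below it. -/
theorem HasUnboundedMap.isRegularUltrafilter_of_succ {J : Type u} {D : Ultrafilter J}
    {κ : Cardinal.{u}} (hκ : ℵ₀ ≤ κ) (h : HasUnboundedMap D (Order.succ κ).ord.ToType) :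
    IsRegularUltrafilter κ κ D := by
  classical
  by_cases hD : HasUnboundedMap D κ.ord.ToType
  · exact hD.isRegularUltrafilter hκ
  obtain ⟨h, hh⟩ := h
  have he : ∀ w : (Order.succ κ).ord.ToType, Nonempty (Set.Iio w ↪ κ.ord.ToType) := fun w => by
    have := mk_Iio_ord_toType_lt w
    rw [Order.lt_succ_iff] at this
    exact this.trans (mk_ord_toType κ).ge
  let e := fun w => (he w).some
  have : Nonempty κ.ord.ToType := by
    rw [← mk_ne_zero_iff, mk_ord_toType]; exact (aleph0_pos.trans_le hκ).ne'
  have hk : ∀ a, ∃ k, ∀ᶠ j in D, ∃ haj : a < h j, e (h j) ⟨a, haj⟩ ≤ k := fun a => by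
    obtain ⟨k, hk⟩ := eventually_le_of_not_hasUnboundedMap hD
      (fun j => if haj : a < h j then e (h j) ⟨a, haj⟩ else Classical.arbitrary _)
    refine ⟨k, ?_⟩
    filter_upwards [hk, hh a] with j h1 h2
    exact ⟨h2, by simpa [h2] using h1⟩
  choose k hk using hk
  obtain ⟨b, hb⟩ := infinite_pigeonhole_card k (Order.succ κ) (mk_ord_toType _).ge
    (hκ.trans (Order.le_succ _))
    (by rw [(isRegular_succ hκ).cof_ord, mk_ord_toType]; exact Order.lt_succ κ)
  refine .of_eventually (aleph0_pos.trans_le hκ) ((Order.le_succ κ).trans hb)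
    (fun j => {a | ∃ haj : a.1 < h j, e (h j) ⟨a, haj⟩ ≤ b}) (.of_forall fun j => ?_) ?_
  · refine lt_of_le_of_lt ?_ (mk_Iic_ord_toType_lt hκ b)
    refine mk_le_of_injective (f := fun a => ⟨e (h j) ⟨a.1.1, a.2.1⟩, a.2.2⟩) ?_
    rintro ⟨⟨a, ha⟩, ha1, ha2⟩ ⟨⟨a', ha'⟩, ha1', ha2'⟩ heq
    have := (e (h j)).injective (congrArg Subtype.val heq)
    obtain rfl : a = a' := by injection this
    rfl
  · rintro ⟨a, rfl⟩
    exact hk a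

theorem IsRegularUltrafilter.hasUnboundedMap {J : Type u} {D : Ultrafilter J} {κ : Cardinal.{u}}
    (hκ : κ.IsRegular) (h : IsRegularUltrafilter κ κ D) : HasUnboundedMap D κ.ord.ToType := by
  obtain ⟨f, hf, hfD⟩ := h.exists_map (mk_ord_toType κ)
  have hb : ∀ j, ∃ b, ∀ x ∈ f j, x < b := fun j =>
    exists_forall_lt_of_mk_lt_cof (by rw [Ordinal.cof_toType, hκ.cof_ord]; exact hf j)
  choose b hb using hb
  exact ⟨b, fun a => (hfD a).mono fun j hj => hb j a hj⟩

/-- A `(κ, κ)`-regular ultrafilter has a map into `κ` or into `κ⁺` which is unbounded. -/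
theorem IsRegularUltrafilter.hasUnboundedMap_or {J : Type u} {D : Ultrafilter J}
    {κ : Cardinal.{u}} (hκ : ℵ₀ ≤ κ) (h : IsRegularUltrafilter κ κ D) :
    HasUnboundedMap D κ.ord.ToType ∨ HasUnboundedMap D (Order.succ κ).ord.ToType := by
  rcases isRegular_or_isSingular hκ with hreg | hsing
  · exact .inl (h.hasUnboundedMap hreg)
  rw [or_iff_not_imp_left]
  intro hD
  obtain ⟨f, hf, hfD⟩ := h.exists_map (mk_ord_toType κ)
  obtain ⟨k, hk⟩ := eventually_le_of_not_hasUnboundedMap hD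
    (fun j => Ordinal.ToType.mk ⟨(#(f j)).ord, ord_lt_ord.2 (hf j)⟩)
  obtain ⟨S, hS, g, hg⟩ := hsing.exists_sparse_family (mk_Iio_ord_toType_lt k)
  have : Nonempty (Order.succ κ).ord.ToType := by
    rw [← mk_ne_zero_iff, mk_ord_toType]; exact (isRegular_succ hκ).ne_zero
  choose! b hb using hg
  refine ⟨fun j => b (f j), fun a => ?_⟩
  -- Otherwise the points beyond which `f j` misses `g a` would be bounded almost everywhere by some
  -- `β`; but for `s ∈ S` above `β`, almost every `f j` contains `g a s`.
  have hcof : ∀ᶠ j in D, ∀ s₀, ∃ s ∈ S, s₀ ≤ s ∧ g a s ∈ f j := by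
    by_contra hno
    rw [← Ultrafilter.eventually_not] at hno
    have hch : ∀ j, ∃ s₀, (¬ ∀ s₀, ∃ s ∈ S, s₀ ≤ s ∧ g a s ∈ f j) →
        ∀ s ∈ S, s₀ ≤ s → g a s ∉ f j := fun j => by
      by_cases hj : ∀ s₀, ∃ s ∈ S, s₀ ≤ s ∧ g a s ∈ f j
      · exact ⟨k, fun h => (h hj).elim⟩
      · push Not at hj
        obtain ⟨s₀, h₀⟩ := hj
        exact ⟨s₀, fun _ => h₀⟩
    choose s₀ hs₀ using hch
    obtain ⟨β, hβ⟩ := eventually_le_of_not_hasUnboundedMap hD s₀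
    obtain ⟨s, hsS, hβs⟩ := hS β
    obtain ⟨j, h1, h2, h3⟩ := (hno.and (hβ.and (hfD (g a s)))).exists
    exact hs₀ j h1 s hsS (h2.trans hβs) h3
  filter_upwards [hcof, hk] with j h1 h2
  refine hb (f j) ?_ a h1
  have h3 := mk_le_mk_of_subset (Set.Iio_subset_Iio h2)
  rwa [Ordinal.mk_Iio_toTypeMk, card_ord] at h3

/-! ### Compactness along an ultrafilter -/

/-- Every `J`-indexed family of points of `X` converges along the ultrafilter `D`. -/
def IsUltrafilterCompact {J : Type u} (D : Ultrafilter J) (X : Type*) [TopologicalSpace X] : Prop :=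
  ∀ f : J → X, ∃ x, Tendsto f D (𝓝 x)

theorem IsUltrafilterCompact.pi {J : Type u} {D : Ultrafilter J} {K : Type*} {X : K → Type*}
    [∀ k, TopologicalSpace (X k)] (h : ∀ k, IsUltrafilterCompact D (X k)) :
    IsUltrafilterCompact D (∀ k, X k) := by
  intro f
  choose x hx using fun k => h k (fun j => f j k)
  exact ⟨x, tendsto_pi_nhds.2 hx⟩

/-- Without a small subcover, choose `x j` outside the sets indexed by `f j`; the limit of `x` along
`D` then lies in no set of the cover. -/
theorem IsUltrafilterCompact.isIntervalCompact {J : Type u} {D : Ultrafilter J}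
    {l m : Cardinal.{u}} (hD : IsRegularUltrafilter l m D) {X : Type u} [TopologicalSpace X]
    (hX : IsUltrafilterCompact D X) : IsIntervalCompact l m X := by
  intro U hU hUm hcover
  obtain ⟨f, hf, hfD⟩ := hD
  obtain ⟨e⟩ : Nonempty (U ↪ m.out) := by
    rw [← mk_out m] at hUm; exact hUm
  by_contra! hno
  have hpt : ∀ j, ∃ x : X, ∀ s : U, e s ∈ f j → x ∉ s.1 := by
    intro j
    have h1 := hno (Subtype.val '' (e ⁻¹' f j)) (by rintro _ ⟨s, -, rfl⟩; exact s.2)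
      (mk_image_le.trans_lt ((mk_preimage_of_injective _ _ e.injective).trans_lt (hf j)))
    obtain ⟨x, hx⟩ := (Set.ne_univ_iff_exists_notMem _).1 h1
    exact ⟨x, fun s hs hxs => hx ⟨s, ⟨s, hs, rfl⟩, hxs⟩⟩
  choose x hx using hpt
  obtain ⟨p, hp⟩ := hX x
  obtain ⟨s, hs, hps⟩ : p ∈ ⋃₀ U := hcover ▸ Set.mem_univ p
  obtain ⟨j, h1, h2⟩ := ((hp.eventually ((hU s hs).mem_nhds hps)).and (hfD (e ⟨s, hs⟩))).exists
  exact hx j ⟨s, hs⟩ h2 h1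

theorem mk_biUnion_finset_lt {A ι : Type u} {l : Cardinal.{u}} (hl : ℵ₀ ≤ l) (hι : #ι < l)
    (F : ι → Finset A) : #(⋃ i, (F i : Set A)) < l := by
  rcases lt_or_ge #ι ℵ₀ with h | h
  · have : Finite ι := lt_aleph0_iff_finite.1 h
    exact (lt_aleph0_iff_set_finite.2 (Set.finite_iUnion fun i => (F i).finite_toSet)).trans_le hl
  · refine lt_of_le_of_lt ((mk_iUnion_le _).trans ?_) hι
    refine (mul_le_mul' le_rfl (ciSup_le' fun i => ?_)).trans (mul_eq_left h h aleph0_ne_zero).le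
    exact (lt_aleph0_iff_set_finite.2 (F i).finite_toSet).le

/-- In an `[l, m]`-compact space, a family of points indexed by the subsets of `m` of size less
than `l` converges along some ultrafilter which contains `{s | a ∈ s}` for every `a ∈ m`. -/
theorem IsIntervalCompact.exists_ultrafilter {l m : Cardinal.{u}} (hl : ℵ₀ ≤ l) (hm : ℵ₀ ≤ m)
    {X : Type u} [TopologicalSpace X] (hX : IsIntervalCompact l m X)
    (x : {s : Set m.out // #s < l} → X) :
    ∃ E : Ultrafilter {s : Set m.out // #s < l}, (∀ a, ∀ᶠ s : {s : Set m.out // #s < l} in E, a ∈ s.1) ∧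
      ∃ p, Tendsto x E (𝓝 p) := by
  classical
  -- Finite index sets make the family `B` directed, while there are still only `m` of them.
  let B : Finset m.out → Set {s : Set m.out // #s < l} := fun F => {s | (F : Set m.out) ⊆ s.1}
  obtain ⟨p, hp⟩ : ∃ p, ∀ F, p ∈ closure (x '' B F) := by
    by_contra! hno
    have hinf : Infinite m.out := by rw [infinite_iff, mk_out]; exact hm
    obtain ⟨V, hVU, hVl, hV⟩ := hX (Set.range fun F => (closure (x '' B F))ᶜ)
      (by rintro _ ⟨F, rfl⟩; exact isClosed_closure.isOpen_compl)
      (mk_range_le.trans (by rw [mk_finset_of_infinite, mk_out]))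
      (by
        refine Set.eq_univ_of_forall fun p => ?_
        obtain ⟨F, hF⟩ := hno p
        exact ⟨_, ⟨F, rfl⟩, hF⟩)
    choose F hF using fun v : V => hVU v.2
    let s : {s : Set m.out // #s < l} := ⟨⋃ v, (F v : Set m.out), mk_biUnion_finset_lt hl hVl F⟩
    obtain ⟨v, hv, hsv⟩ : x s ∈ ⋃₀ V := hV ▸ Set.mem_univ _
    have := hF ⟨v, hv⟩
    dsimp only at this
    rw [← this] at hsv
    exact hsv (subset_closure ⟨s, Set.subset_iUnion (fun v => (F v : Set m.out)) ⟨v, hv⟩, rfl⟩)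
  have hne : NeBot (comap x (𝓝 p) ⊓ ⨅ F, 𝓟 (B F)) := by
    have hdir : Directed (· ≥ ·) fun F => 𝓟 (B F) := by
      intro F F'
      refine ⟨F ∪ F', principal_mono.2 fun s hs => ?_, principal_mono.2 fun s hs => ?_⟩
      · exact fun a ha => hs (Finset.mem_coe.2 (Finset.mem_union_left _ ha))
      · exact fun a ha => hs (Finset.mem_coe.2 (Finset.mem_union_right _ ha))
    rw [inf_neBot_iff]
    intro N hN N' hN'
    obtain ⟨O, hO, hON⟩ := hN
    obtain ⟨F, hF⟩ := (mem_iInf_of_directed hdir _).1 hN'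
    obtain ⟨_, h1, s, hs, rfl⟩ := mem_closure_iff_nhds.1 (hp F) O hO
    exact ⟨s, hON h1, hF hs⟩
  refine ⟨Ultrafilter.of (comap x (𝓝 p) ⊓ ⨅ F, 𝓟 (B F)), fun a => ?_, p, ?_⟩
  · have h1 : B {a} ∈ ⨅ F, 𝓟 (B F) := mem_iInf_of_mem {a} (mem_principal_self _)
    filter_upwards [Ultrafilter.of_le _ (mem_inf_of_right h1)] with s hs
    exact hs (by simp)
  · exact tendsto_iff_comap.2 ((Ultrafilter.of_le _).trans inf_le_left)

/-- A productively `[l, m]`-compact family is compact with respect to some `(l, m)`-regular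
ultrafilter. -/
theorem IsProductivelyCompactFamily.exists_ultrafilter {l m : Cardinal.{u}} (hl : ℵ₀ ≤ l)
    (hm : ℵ₀ ≤ m) {ι : Type u} {X : ι → Type u} [∀ i, TopologicalSpace (X i)]
    (hX : IsProductivelyCompactFamily l m X) :
    ∃ E : Ultrafilter {s : Set m.out // #s < l}, IsRegularUltrafilter l m E ∧
      ∀ i, IsUltrafilterCompact E (X i) := by
  by_contra! hno
  simp only [IsUltrafilterCompact, not_forall] at hno
  -- One counterexample for each regular ultrafilter on this fixed set, all placed in a single
  -- product: an ultrafilter along which they converge jointly refutes its own counterexample.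
  choose i f hf using fun D : {D : Ultrafilter {s : Set m.out // #s < l} //
    IsRegularUltrafilter l m D} => hno D.1 D.2
  obtain ⟨E, hE, p, hp⟩ := IsIntervalCompact.exists_ultrafilter hl hm (hX _ i) (fun s D => f D s)
  have hEreg : IsRegularUltrafilter l m E := ⟨fun s => s.1, fun s => s.2, hE⟩
  exact hf ⟨E, hEreg⟩ ⟨p ⟨E, hEreg⟩, tendsto_pi_nhds.1 hp _⟩

theorem IsProductivelyCompact.exists_ultrafilter {l m : Cardinal.{u}} (hl : ℵ₀ ≤ l)
    (hm : ℵ₀ ≤ m) {X : Type u} [TopologicalSpace X] (hX : IsProductivelyCompact l m X) :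
    ∃ E : Ultrafilter {s : Set m.out // #s < l}, IsRegularUltrafilter l m E ∧
      IsUltrafilterCompact E X := by
  obtain ⟨E, hE, h⟩ := IsProductivelyCompactFamily.exists_ultrafilter hl hm
    (X := fun _ : PUnit => X) fun K _ => hX K
  exact ⟨E, hE, h ⟨⟩⟩

theorem IsUltrafilterCompact.isProductivelyCompact {J : Type u} {D : Ultrafilter J}
    {l m : Cardinal.{u}} (hD : IsRegularUltrafilter l m D) {X : Type u} [TopologicalSpace X]
    (hX : IsUltrafilterCompact D X) : IsProductivelyCompact l m X :=
  fun _ => (IsUltrafilterCompact.pi fun _ => hX).isIntervalCompact hD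

theorem IsIntervalCompact.of_surjective {l m : Cardinal.{u}} {X Y : Type u} [TopologicalSpace X]
    [TopologicalSpace Y] (hX : IsIntervalCompact l m X) {f : X → Y} (hf : Continuous f)
    (hsurj : Function.Surjective f) : IsIntervalCompact l m Y := by
  intro U hU hUm hcover
  obtain ⟨V, hVU, hVl, hV⟩ := hX (Set.preimage f '' U)
    (by rintro _ ⟨s, hs, rfl⟩; exact (hU s hs).preimage hf) (mk_image_le.trans hUm)
    (by rw [Set.sUnion_image, ← Set.preimage_iUnion₂, ← Set.sUnion_eq_biUnion, hcover,
      Set.preimage_univ])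
  refine ⟨{s ∈ U | f ⁻¹' s ∈ V}, fun s hs => hs.1, lt_of_le_of_lt ?_ hVl, ?_⟩
  · refine mk_le_of_injective (f := fun s => ⟨f ⁻¹' s.1, s.2.2⟩) fun s t h => ?_
    exact Subtype.ext (hsurj.preimage_injective (congrArg Subtype.val h))
  · refine Set.eq_univ_of_forall fun y => ?_
    obtain ⟨x, rfl⟩ := hsurj y
    obtain ⟨t, ht, hxt⟩ : x ∈ ⋃₀ V := hV ▸ Set.mem_univ x
    obtain ⟨s, hs, rfl⟩ := hVU ht
    exact ⟨s, ⟨hs, ht⟩, hxt⟩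

theorem IsProductivelyCompact.isIntervalCompact {l m : Cardinal.{u}} {X : Type u}
    [TopologicalSpace X] (hX : IsProductivelyCompact l m X) : IsIntervalCompact l m X :=
  (hX PUnit).of_surjective (continuous_apply PUnit.unit) fun x => ⟨fun _ => x, rfl⟩

/-! ### Spaces of ordinals -/

theorem HasClopenBase.of_isInducing {X : Type u} {Y : Type v} [TopologicalSpace X]
    [TopologicalSpace Y] {f : X → Y} (hf : IsInducing f) (hY : HasClopenBase Y) :
    HasClopenBase X := by
  refine TopologicalSpace.isTopologicalBasis_of_isOpen_of_nhds (fun s hs => hs.isOpen) ?_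
  intro x U hxU hU
  obtain ⟨V, hV, rfl⟩ := hf.isOpen_iff.1 hU
  obtain ⟨W, hW, hxW, hWV⟩ := TopologicalSpace.IsTopologicalBasis.exists_subset_of_mem_open hY
    (a := f x) hxU hV
  exact ⟨f ⁻¹' W, hW.preimage hf.continuous, hxW, fun z hz => hWV hz⟩

theorem Ordinal.hasClopenBase : HasClopenBase Ordinal.{u} := by
  refine TopologicalSpace.isTopologicalBasis_of_isOpen_of_nhds (fun s hs => hs.isOpen) ?_
  intro a U ha hU
  by_cases hlim : Order.IsSuccLimit a
  · obtain ⟨b, hba, hb⟩ := SuccOrder.isOpen_iff.1 hU a ha hlim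
    refine ⟨Set.Ioc b a, ⟨?_, ?_⟩, ⟨hba, le_rfl⟩, fun z hz => ?_⟩
    · rw [← Order.Icc_succ_left]; exact isClosed_Icc
    · rw [← Order.Ioo_succ_right]; exact isOpen_Ioo
    · rcases hz.2.eq_or_lt with rfl | h
      · exact ha
      · exact hb ⟨hz.1, h⟩
  · exact ⟨{a}, ⟨isClosed_singleton, SuccOrder.isOpen_singleton_iff.2 hlim⟩, rfl,
      Set.singleton_subset_iff.2 ha⟩


/-- The ordinals up to `Ω`, without those limits to which no `D`-unbounded map exists. -/
def ultrafilterOrdinals {J : Type u} (D : Ultrafilter J) (Ω : Ordinal.{u}) : Set Ordinal.{u} :=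
  {a | a ≤ Ω ∧ (Order.IsSuccLimit a → HasUnboundedMap D a.ToType)}

instance small_ultrafilterOrdinals {J : Type u} (D : Ultrafilter J) (Ω : Ordinal.{u}) :
    Small.{u} (ultrafilterOrdinals D Ω) :=
  small_subset (s := Set.Iic Ω) fun _ h => h.1

/-- A limit exists in the compact interval up to `Ω`. If it is a limit ordinal not attained almost
everywhere, the family itself is an unbounded map into it, so it was not removed. -/
theorem isUltrafilterCompact_ultrafilterOrdinals {J : Type u} (D : Ultrafilter J)
    (Ω : Ordinal.{u}) : IsUltrafilterCompact D (Shrink.{u} (ultrafilterOrdinals D Ω)) := by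
  classical
  intro f
  let φ := Shrink.homeomorph.{u} (ultrafilterOrdinals D Ω)
  let h : J → Ordinal.{u} := fun j => (φ.symm (f j)).1
  have hh : ∀ j, h j ∈ ultrafilterOrdinals D Ω := fun j => (φ.symm (f j)).2
  obtain ⟨p, hp, hpD⟩ := (isCompact_Icc (a := (0 : Ordinal.{u})) (b := Ω)).ultrafilter_le_nhds
    (D.map h) (by
      rw [le_principal_iff]
      exact Filter.univ_mem' (f := (D : Filter J)) fun j => ⟨bot_le, (hh j).1⟩)
  have hlim : Tendsto h D (𝓝 p) := hpD
  have hmem : p ∈ ultrafilterOrdinals D Ω := by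
    refine ⟨hp.2, fun hl => ?_⟩
    by_cases hev : ∀ᶠ j in D, h j = p
    · obtain ⟨j, hj⟩ := hev.exists
      exact (hj ▸ (hh j).2) hl
    · rw [← Ultrafilter.eventually_not] at hev
      have hle : ∀ᶠ j in D, h j < Order.succ p :=
        hlim.eventually (isOpen_Iio.mem_nhds (Order.lt_succ p))
      have hlt : ∀ᶠ j in D, h j < p := by
        filter_upwards [hev, hle] with j h1 h2
        exact lt_of_le_of_ne (Order.lt_succ_iff.1 h2) h1
      have hp0 : 0 < p := hl.bot_lt
      refine ⟨fun j => Ordinal.ToType.mk (if hj : h j < p then ⟨h j, hj⟩ else ⟨0, hp0⟩),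
        fun a => ?_⟩
      have ha : ∀ᶠ j in D, a.toOrd.1 < h j :=
        hlim.eventually (isOpen_Ioi.mem_nhds a.toOrd.2)
      filter_upwards [ha, hlt] with j h1 h2
      rw [dif_pos h2, ← Ordinal.ToType.mk.symm.lt_iff_lt, OrderIso.symm_apply_apply]
      exact h1
  refine ⟨φ ⟨p, hmem⟩, ?_⟩
  have h1 : Tendsto (fun j => φ.symm (f j)) D (𝓝 ⟨p, hmem⟩) := tendsto_subtype_rng.2 hlim
  have h2 := (φ.continuous.tendsto _).comp h1
  refine h2.congr fun j => ?_
  simp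

/-- Successors along an unbounded map into a limit ordinal converge to this limit, hence to no point
of the space of ordinals from which it has been removed. -/
theorem exists_forall_not_tendsto_ultrafilterOrdinals {J : Type u} {D : Ultrafilter J}
    {Ω o : Ordinal.{u}} (ho : Order.IsSuccLimit o) (hoΩ : o ≤ Ω)
    (hD : ¬ HasUnboundedMap D o.ToType) :
    ∃ x : o.ToType → Shrink.{u} (ultrafilterOrdinals D Ω), ∀ (L : Type u) (E : Ultrafilter L)
      (h : L → o.ToType), (∀ a, ∀ᶠ j in E, a < h j) →
        ∀ p, ¬ Tendsto (fun j => x (h j)) E (𝓝 p) := by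
  let φ := Shrink.homeomorph.{u} (ultrafilterOrdinals D Ω)
  have hlt : ∀ a : o.ToType, Order.succ (a.toOrd : Ordinal.{u}) < o := fun a =>
    ho.succ_lt a.toOrd.2
  have hmem : ∀ a : o.ToType, Order.succ (a.toOrd : Ordinal.{u}) ∈ ultrafilterOrdinals D Ω :=
    fun a => ⟨(hlt a).le.trans hoΩ, fun hl => (Order.not_isSuccLimit_succ _ hl).elim⟩
  refine ⟨fun a => φ ⟨_, hmem a⟩, fun L E h hh p hp => ?_⟩
  have h1 := (φ.symm.continuous.tendsto p).comp hp
  have h2 := (continuous_subtype_val.tendsto _).comp h1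
  have h3 : Tendsto (fun j => Order.succ ((h j).toOrd : Ordinal.{u})) E (𝓝 o) := by
    refine tendsto_order.2 ⟨fun a ha => ?_, fun a ha => .of_forall fun j => (hlt _).trans ha⟩
    filter_upwards [hh (Ordinal.ToType.mk ⟨a, ha⟩)] with j hj
    rw [← Ordinal.ToType.mk.symm.lt_iff_lt, OrderIso.symm_apply_apply] at hj
    exact lt_trans (b := ((h j).toOrd : Ordinal.{u})) hj (Order.lt_succ _)
  have h4 : ((φ.symm p).1 : Ordinal.{u}) = o :=
    tendsto_nhds_unique (h2.congr fun j => by simp) h3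
  have h5 := (φ.symm p).2
  rw [h4] at h5
  exact hD (h5.2 ho)

theorem t5Space_ultrafilterOrdinals {J : Type u} (D : Ultrafilter J) (Ω : Ordinal.{u}) :
    T5Space (Shrink.{u} (ultrafilterOrdinals D Ω)) :=
  (Shrink.homeomorph.{u} (ultrafilterOrdinals D Ω)).t5Space

theorem hasClopenBase_ultrafilterOrdinals {J : Type u} (D : Ultrafilter J) (Ω : Ordinal.{u}) :
    HasClopenBase (Shrink.{u} (ultrafilterOrdinals D Ω)) :=
  .of_isInducing (IsInducing.subtypeVal.comp
    (Shrink.homeomorph.{u} (ultrafilterOrdinals D Ω)).symm.isInducing) Ordinal.hasClopenBase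

/-! ### The group of functions with small support -/

/-- The functions into `{1, -1}` on the disjoint union of the `κ i`, whose support meets each `κ i`
in a set of size less than `κ i`. -/
def smallSupportSubgroup {I : Type u} (κ : I → Cardinal.{u}) (hκ : ∀ i, ℵ₀ ≤ κ i) :
    Subgroup ((Σ i, (κ i).out) → ℤˣ) where
  carrier := {x | ∀ i, #{a | x ⟨i, a⟩ ≠ 1} < κ i}
  one_mem' i := by simpa using aleph0_pos.trans_le (hκ i)
  mul_mem' {x y} hx hy i := by
    refine lt_of_le_of_lt (mk_le_mk_of_subset ?_) ((mk_union_le _ _).trans_lt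
      (add_lt_of_lt (hκ i) (hx i) (hy i)))
    intro a ha
    by_contra hno
    simp only [Set.mem_union, Set.mem_ofPred_eq, not_or, not_not] at hno
    exact ha (by simp [hno.1, hno.2])
  inv_mem' {x} hx i := by simpa using hx i

/-- If the pointwise limit had large support in block `i`, the supports of the `f j`, restricted to
it, would witness `(κ i, κ i)`-regularity of `D`. -/
theorem isUltrafilterCompact_smallSupportSubgroup {I : Type u} {κ : I → Cardinal.{u}}
    (hκ : ∀ i, ℵ₀ ≤ κ i) {J : Type u} {D : Ultrafilter J}
    (hD : ∀ i, ¬ IsRegularUltrafilter (κ i) (κ i) D) :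
    IsUltrafilterCompact D (smallSupportSubgroup κ hκ) := by
  intro f
  obtain ⟨p, -, hp⟩ := isCompact_univ.ultrafilter_le_nhds (D.map fun j => (f j).1) (by simp)
  have hlim : Tendsto (fun j => (f j).1) D (𝓝 p) := hp
  have hmem : p ∈ smallSupportSubgroup κ hκ := by
    intro i
    by_contra! hi
    refine hD i (.of_eventually (aleph0_pos.trans_le (hκ i)) hi
      (fun j => Subtype.val ⁻¹' {a | (f j).1 ⟨i, a⟩ ≠ 1}) (.of_forall fun j => ?_) ?_)
    · exact (mk_preimage_of_injective _ _ Subtype.val_injective).trans_lt ((f j).2 i)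
    · rintro ⟨a, ha⟩
      exact (tendsto_pi_nhds.1 hlim ⟨i, a⟩).eventually_ne ha
  exact ⟨⟨p, hmem⟩, tendsto_subtype_rng.2 hlim⟩

theorem not_isIntervalCompact_smallSupportSubgroup {I : Type u} {κ : I → Cardinal.{u}}
    (hκ : ∀ i, ℵ₀ ≤ κ i) (i : I) :
    ¬ IsIntervalCompact (κ i) (κ i) (smallSupportSubgroup κ hκ) := by
  classical
  intro h
  obtain ⟨V, hVU, hVl, hV⟩ := h
    (Set.range fun a : (κ i).out => {x : smallSupportSubgroup κ hκ | x.1 ⟨i, a⟩ = 1})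
    (by
      rintro _ ⟨a, rfl⟩
      have hc : Continuous fun x : smallSupportSubgroup κ hκ => x.1 ⟨i, a⟩ :=
        (continuous_apply (A := fun _ : Σ i, (κ i).out => ℤˣ) ⟨i, a⟩).comp continuous_subtype_val
      exact (isOpen_discrete {(1 : ℤˣ)}).preimage hc)
    (mk_range_le.trans (mk_out _).le)
    (by
      refine Set.eq_univ_of_forall fun x => ?_
      by_contra hno
      have hx := x.2 i
      have : {a | x.1 ⟨i, a⟩ ≠ 1} = Set.univ := Set.eq_univ_of_forall fun a ha =>
        hno ⟨_, ⟨a, rfl⟩, ha⟩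
      rw [this, mk_univ, mk_out] at hx
      exact hx.false)
  choose a ha using fun v : V => hVU v.2
  -- A small subfamily of the cover uses few coordinates `R`; the function equal to `-1` exactly on
  -- `R` has small support and escapes all of its sets.
  let R : Set (Σ i, (κ i).out) := Set.range fun v => ⟨i, a v⟩
  let x : (Σ i, (κ i).out) → ℤˣ := fun q => if q ∈ R then -1 else 1
  have hx : x ∈ smallSupportSubgroup κ hκ := by
    intro i'
    have hsub : {b | x ⟨i', b⟩ ≠ 1} ⊆ Sigma.mk (β := fun i => (κ i).out) i' ⁻¹' R := by
      intro b hb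
      by_contra hno
      exact hb (if_neg hno)
    by_cases hii : i' = i
    · subst hii
      exact (mk_le_mk_of_subset hsub).trans_lt ((mk_preimage_of_injective _ _
        sigma_mk_injective).trans_lt (mk_range_le.trans_lt hVl))
    · have : {b | x ⟨i', b⟩ ≠ 1} = ∅ := by
        refine Set.eq_empty_of_forall_notMem fun b hb => ?_
        obtain ⟨v, hv⟩ := hsub hb
        exact hii (congrArg Sigma.fst hv).symm
      simpa only [this, mk_eq_zero] using aleph0_pos.trans_le (hκ i')
  obtain ⟨v, hv, hxv⟩ : (⟨x, hx⟩ : smallSupportSubgroup κ hκ) ∈ ⋃₀ V := hV ▸ Set.mem_univ _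
  have h1 := ha ⟨v, hv⟩
  dsimp only at h1
  rw [← h1] at hxv
  have h2 : x ⟨i, a ⟨v, hv⟩⟩ = -1 := if_pos ⟨_, rfl⟩
  have h3 : x ⟨i, a ⟨v, hv⟩⟩ = 1 := hxv
  rw [h2] at h3
  exact absurd h3 (by decide)

/-! ### Failure of compactness for the spaces of ordinals -/

/-- The order space of `D` is not `E`-compact if `E` is `(κ, κ)`-regular and `D` is not. -/
theorem not_isUltrafilterCompact_ultrafilterOrdinals {J L : Type u} {D : Ultrafilter J}
    {E : Ultrafilter L} {κ : Cardinal.{u}} (hκ : ℵ₀ ≤ κ) (hD : ¬ IsRegularUltrafilter κ κ D)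
    (hE : IsRegularUltrafilter κ κ E) {Ω : Ordinal.{u}} (hΩ : (Order.succ κ).ord ≤ Ω) :
    ¬ IsUltrafilterCompact E (Shrink.{u} (ultrafilterOrdinals D Ω)) := by
  intro hX
  rcases hE.hasUnboundedMap_or hκ with ⟨h, hh⟩ | ⟨h, hh⟩
  · obtain ⟨x, hx⟩ := exists_forall_not_tendsto_ultrafilterOrdinals (Cardinal.isSuccLimit_ord hκ)
      ((ord_le_ord.2 (Order.le_succ κ)).trans hΩ) (fun h => hD (h.isRegularUltrafilter hκ))
    obtain ⟨p, hp⟩ := hX fun j => x (h j)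
    exact hx _ E h hh p hp
  · obtain ⟨x, hx⟩ := exists_forall_not_tendsto_ultrafilterOrdinals
      (Cardinal.isSuccLimit_ord (hκ.trans (Order.le_succ κ))) hΩ
      (fun h => hD (h.isRegularUltrafilter_of_succ hκ))
    obtain ⟨p, hp⟩ := hX fun j => x (h j)
    exact hx _ E h hh p hp

/-- For regular `κ` no powers are needed: sets of size less than `κ` are bounded in `κ`, so the
ultrafilter obtained from `[κ, κ]`-compactness already has an unbounded map into `κ`, a limit which
has been removed. -/
theorem not_isIntervalCompact_ultrafilterOrdinals {J : Type u} {D : Ultrafilter J}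
    {κ : Cardinal.{u}} (hκ : κ.IsRegular) (hD : ¬ IsRegularUltrafilter κ κ D)
    {Ω : Ordinal.{u}} (hΩ : (Order.succ κ).ord ≤ Ω) :
    ¬ IsIntervalCompact κ κ (Shrink.{u} (ultrafilterOrdinals D Ω)) := by
  intro hX
  obtain ⟨e⟩ : Nonempty (κ.out ≃ κ.ord.ToType) := by
    rw [← Cardinal.eq, mk_out, mk_ord_toType]
  have hb : ∀ s : {s : Set κ.out // #s < κ}, ∃ b, ∀ y ∈ e '' s.1, y < b := fun s =>
    exists_forall_lt_of_mk_lt_cof (by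
      rw [Ordinal.cof_toType, hκ.cof_ord]; exact mk_image_le.trans_lt s.2)
  choose b hb using hb
  obtain ⟨x, hx⟩ := exists_forall_not_tendsto_ultrafilterOrdinals (Cardinal.isSuccLimit_ord hκ.1)
    ((ord_le_ord.2 (Order.le_succ κ)).trans hΩ) (fun h => hD (h.isRegularUltrafilter hκ.1))
  obtain ⟨E, hE, p, hp⟩ := hX.exists_ultrafilter hκ.1 hκ.1 fun s => x (b s)
  refine hx _ E b (fun a => ?_) p hp
  filter_upwards [hE (e.symm a)] with s hs
  exact hb s a ⟨_, hs, by simp⟩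

theorem isProductivelyCompact_ultrafilterOrdinals {l m : Cardinal.{u}} {J : Type u}
    {D : Ultrafilter J} (hD : IsRegularUltrafilter l m D) (Ω : Ordinal.{u}) :
    IsProductivelyCompact l m (Shrink.{u} (ultrafilterOrdinals D Ω)) :=
  (isUltrafilterCompact_ultrafilterOrdinals D Ω).isProductivelyCompact hD

/-! ### The equivalences -/

theorem theorem4 (l m : Cardinal.{u}) (hl : ℵ₀ ≤ l) (hm : ℵ₀ ≤ m)
    {I : Type u} (κ : I → Cardinal.{u}) (hκ : ∀ i, ℵ₀ ≤ κ i) :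
    List.TFAE [
      -- (i), without the parenthesized "productively"
      ∀ (X : Type u) [TopologicalSpace X], IsProductivelyCompact l m X →
        ∃ i, IsIntervalCompact (κ i) (κ i) X,
      -- (i), with "productively"
      ∀ (X : Type u) [TopologicalSpace X], IsProductivelyCompact l m X →
        ∃ i, IsProductivelyCompact (κ i) (κ i) X,
      -- (ii)
      ∀ (J : Type u) (X : J → Type u) [∀ j, TopologicalSpace (X j)],
        IsProductivelyCompactFamily l m X → ∃ i, IsProductivelyCompactFamily (κ i) (κ i) X,
      -- (iii)
      ∀ (J : Type u) (D : Ultrafilter J), IsRegularUltrafilter l m D →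
        ∃ i, IsRegularUltrafilter (κ i) (κ i) D,
      -- (iv)
      ∀ (X : Type u) [TopologicalSpace X], T2Space X → NormalSpace X → HasClopenBase X →
        IsProductivelyCompact l m X → ∃ i, IsProductivelyCompact (κ i) (κ i) X,
      -- (v), without the parenthesized "productively"
      ∀ (G : Type u) [TopologicalSpace G] [Group G] [IsTopologicalGroup G],
        T35Space G → HasClopenBase G → IsProductivelyCompact l m G →
        ∃ i, IsIntervalCompact (κ i) (κ i) G,
      -- (v), with "productively"
      ∀ (G : Type u) [TopologicalSpace G] [Group G] [IsTopologicalGroup G],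
        T35Space G → HasClopenBase G → IsProductivelyCompact l m G →
        ∃ i, IsProductivelyCompact (κ i) (κ i) G] ∧
    -- (vi) is equivalent to the preceding conditions if every `κ i` is regular
    ((∀ i, (κ i).IsRegular) →
      ((∀ (X : Type u) [TopologicalSpace X], T2Space X → NormalSpace X → HasClopenBase X →
          IsProductivelyCompact l m X → ∃ i, IsIntervalCompact (κ i) (κ i) X) ↔
        ∀ (X : Type u) [TopologicalSpace X], IsProductivelyCompact l m X →
          ∃ i, IsIntervalCompact (κ i) (κ i) X)) := by
  -- This bound puts every `κ i` and its successor among the ordinals considered.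
  have hΩ : ∀ i, (Order.succ (κ i)).ord ≤ ⨆ i, (Order.succ (κ i)).ord := fun i =>
    Ordinal.le_iSup (fun i => (Order.succ (κ i)).ord) i
  have h32 : (∀ (J : Type u) (D : Ultrafilter J), IsRegularUltrafilter l m D →
      ∃ i, IsRegularUltrafilter (κ i) (κ i) D) →
      ∀ (J : Type u) (X : J → Type u) [∀ j, TopologicalSpace (X j)],
        IsProductivelyCompactFamily l m X → ∃ i, IsProductivelyCompactFamily (κ i) (κ i) X := by
    intro h J X _ hX
    obtain ⟨E, hE, hEX⟩ := hX.exists_ultrafilter hl hm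
    obtain ⟨i, hi⟩ := h _ E hE
    exact ⟨i, fun K g => (IsUltrafilterCompact.pi fun k => hEX (g k)).isIntervalCompact hi⟩
  have h21 : (∀ (J : Type u) (X : J → Type u) [∀ j, TopologicalSpace (X j)],
      IsProductivelyCompactFamily l m X → ∃ i, IsProductivelyCompactFamily (κ i) (κ i) X) →
      ∀ (X : Type u) [TopologicalSpace X], IsProductivelyCompact l m X →
        ∃ i, IsProductivelyCompact (κ i) (κ i) X := by
    intro h X _ hX
    obtain ⟨i, hi⟩ := h PUnit (fun _ => X) fun K _ => hX K
    exact ⟨i, fun K => hi K fun _ => ⟨⟩⟩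
  refine ⟨?_, fun hreg => ⟨fun h X _ hX => ?_, fun h X _ _ _ _ hX => h X hX⟩⟩
  · tfae_have 2 → 1 := fun h X _ hX => (h X hX).imp fun _ => IsProductivelyCompact.isIntervalCompact
    tfae_have 4 → 3 := h32
    tfae_have 3 → 2 := h21
    tfae_have 1 → 6 := fun h G _ _ _ _ _ hG => h G hG
    tfae_have 2 → 7 := fun h G _ _ _ _ _ hG => h G hG
    tfae_have 7 → 6 := fun h G _ _ _ h1 h2 hG =>
      (h G h1 h2 hG).imp fun _ => IsProductivelyCompact.isIntervalCompact
    tfae_have 2 → 5 := fun h X _ _ _ _ hX => h X hX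
    tfae_have 6 → 4 := by
      intro h J D hD
      by_contra! hno
      obtain ⟨i, hi⟩ := h (smallSupportSubgroup κ hκ) inferInstance
        (.of_isInducing IsInducing.subtypeVal isTopologicalBasis_isClopen)
        ((isUltrafilterCompact_smallSupportSubgroup hκ hno).isProductivelyCompact hD)
      exact not_isIntervalCompact_smallSupportSubgroup hκ i hi
    tfae_have 5 → 4 := by
      intro h J D hD
      by_contra! hno
      have := t5Space_ultrafilterOrdinals D (⨆ i, (Order.succ (κ i)).ord)
      obtain ⟨i, hi⟩ := h _ inferInstance inferInstance
        (hasClopenBase_ultrafilterOrdinals D (⨆ i, (Order.succ (κ i)).ord))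
        (isProductivelyCompact_ultrafilterOrdinals hD _)
      -- Productive compactness is needed here for singular `κ i`: it yields a regular `E` along
      -- which the space itself is compact.
      obtain ⟨E, hE, hEX⟩ := hi.exists_ultrafilter (hκ i) (hκ i)
      exact not_isUltrafilterCompact_ultrafilterOrdinals (hκ i) (hno i) hE (hΩ i) hEX
    tfae_finish
  · refine (h21 (h32 fun J D hD => ?_) X hX).imp fun _ => IsProductivelyCompact.isIntervalCompact
    by_contra! hno
    have := t5Space_ultrafilterOrdinals D (⨆ i, (Order.succ (κ i)).ord)
    obtain ⟨i, hi⟩ := h _ inferInstance inferInstance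
      (hasClopenBase_ultrafilterOrdinals D (⨆ i, (Order.succ (κ i)).ord))
      (isProductivelyCompact_ultrafilterOrdinals hD _)
    exact not_isIntervalCompact_ultrafilterOrdinals (hreg i) (hno i) (hΩ i) hi
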